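/- Let $Y$ be a non-zero real Banach space with the Daugavet property, i.e. $\|I+T\|=1+\|T\|$ for every bounded rank-one operator $T\colon Y\to Y$. A slice of a bounded set $A\subset Y$ is a non-empty set of the form $S(A,y^*,\varepsilon)=\{x\in A: y^*(x)>\sup_{a\in A} y^*(a)-\varepsilon\}$ with $y^*\in Y^*\setminus\{0\}$ and $\varepsilon>0$. A bounded set $A$ is called SCD (slicely countably determined) if there is a sequence $(S_n)_{n\in\mathbb N}$ of slices of $A$ such that $A\subset\overline{\operatorname{conv}}(B)$ for every $B\subset Y$ that intersects all the $S_n$. A set $C$ is called symmetric if $-C=C$. **Theorem.** There are convex, closed, bounded, symmetric SCD sets $C_1,C_2\subset Y$ whose intersection $C_1\cap C_2$ is not SCD. If, in addition, $Y$ is separable, then such sets $C_1,C_2$ can be chosen to be bodies, i.e. to have non-empty interior. -/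

import Mathlib

section SlicelyCountablyDetermined

variable {X : Type*} [NormedAddCommGroup X] [NormedSpace ℝ X]

/-- The set `S(A, f, ε) = {x ∈ A : f x > sup f(A) - ε}`. -/
noncomputable def sliceSet (A : Set X) (f : X →L[ℝ] ℝ) (ε : ℝ) : Set X :=
  {x | x ∈ A ∧ sSup (f '' A) - ε < f x}

/-- `S` is a slice of the (bounded) set `A`: a non-empty set of the form `S(A, f, ε)` with
`f` a non-zero bounded real functional and `ε > 0`. -/
def IsSlice (A S : Set X) : Prop :=
  S.Nonempty ∧ ∃ f : X →L[ℝ] ℝ, f ≠ 0 ∧ ∃ ε : ℝ, 0 < ε ∧ S = sliceSet A f ε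

/-- A sequence of non-empty subsets `U n` of `A` is determining for `A` if `A` lies in the closed
convex hull of every `B ⊆ X` that intersects all the `U n`. -/
def IsDetermining (A : Set X) (U : ℕ → Set X) : Prop :=
  (∀ n, (U n).Nonempty ∧ U n ⊆ A) ∧
    ∀ B : Set X, (∀ n, (B ∩ U n).Nonempty) → A ⊆ closure (convexHull ℝ B)

/-- Slicely countably determined (SCD) sets: bounded sets having a determining sequence of
slices. -/
def IsSCD (A : Set X) : Prop :=
  Bornology.IsBounded A ∧ ∃ U : ℕ → Set X, (∀ n, IsSlice A (U n)) ∧ IsDetermining A U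

/-- Convex closed bounded sets that are symmetric with respect to zero. -/
structure IsSymmetricConvexClosedBounded (C : Set X) : Prop where
  convex : Convex ℝ C
  isClosed : IsClosed C
  isBounded : Bornology.IsBounded C
  neg_mem : ∀ x ∈ C, -x ∈ C

variable (X) in
/-- The Daugavet property: every bounded operator `T` of rank one satisfies the Daugavet equation
`‖I + T‖ = 1 + ‖T‖`. -/
def HasDaugavetProperty : Prop :=
  ∀ T : X →L[ℝ] X, Module.finrank ℝ (LinearMap.range (T : X →ₗ[ℝ] X)) = 1 →
    ‖ContinuousLinearMap.id ℝ X + T‖ = 1 + ‖T‖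

end SlicelyCountablyDetermined

/-!
In a space with the Daugavet property, every cap of the unit ball contains points that are almost
`ℓ¹`-orthogonal to a prescribed finite-dimensional subspace. Hence, for `G` finite-dimensional, one
can choose points of countably many given caps of the unit ball of `X ⧸ G` such that their closed
span misses a given vector: this ball is not SCD, and neither is its product with another set.

If `dim G = 2`, then `X` is isomorphic to `(X ⧸ G) × ℝ × ℝ`, where the unit box is not SCD. For
separable `X` it is the intersection of two bodies, obtained by attaching spikes in the direction of
the first, respectively of the second, scalar coordinate. The tips of the spikes form a countable
set of denting points whose closed convex hull is the whole body, so that the body is SCD.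

Stated in terms of closed convex hulls, the Daugavet property passes to suitable separable
subspaces, and this settles the non-separable case.
-/

section CounterexampleToIntersections

open Set Filter Topology Bornology Metric

section Caps

variable {X Z : Type*} [NormedAddCommGroup X] [NormedSpace ℝ X] [NormedAddCommGroup Z]
  [NormedSpace ℝ Z]

/-- The part of `A` in the open half-space `c < f`. Up to the choice of the level, these are the
slices of `A`; the zero functional is allowed so that caps are stable under restricting functionals
to subspaces and under fixing coordinates in products. -/
def cap (A : Set X) (f : X →L[ℝ] ℝ) (c : ℝ) : Set X :=
  {x | x ∈ A ∧ c < f x}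

theorem isSlice_cap_of_ne_zero {A : Set X} {f : X →L[ℝ] ℝ} {c : ℝ} (hA : IsBounded A)
    (hf : f ≠ 0) (hne : (cap A f c).Nonempty) : IsSlice A (cap A f c) := by
  refine ⟨hne, f, hf, sSup (f '' A) - c, ?_, by simp only [sliceSet, cap, sub_sub_cancel]⟩
  obtain ⟨x, hxA, hcx⟩ := hne
  have hle : f x ≤ sSup (f '' A) :=
    le_csSup (f.lipschitz.isBounded_image hA).bddAbove (mem_image_of_mem f hxA)
  exact sub_pos.2 (hcx.trans_le hle)

theorem isSlice_cap [Nontrivial X] {A : Set X} {f : X →L[ℝ] ℝ} {c : ℝ} (hA : IsBounded A)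
    (hne : (cap A f c).Nonempty) : IsSlice A (cap A f c) := by
  rcases eq_or_ne f 0 with rfl | hf
  · obtain ⟨x, hxA, hc⟩ := hne
    obtain ⟨g, hg⟩ := exists_ne (0 : X →L[ℝ] ℝ)
    obtain ⟨m, hm⟩ := (g.lipschitz.isBounded_image hA).bddBelow
    have hgA : ∀ y ∈ A, m - 1 < g y := fun y hy => by
      linarith [hm (mem_image_of_mem g hy)]
    have hcap : cap A (0 : X →L[ℝ] ℝ) c = cap A g (m - 1) :=
      Set.ext fun y => ⟨fun hy => ⟨hy.1, hgA y hy.1⟩, fun hy => ⟨hy.1, hc⟩⟩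
    rw [hcap]
    exact isSlice_cap_of_ne_zero hA hg ⟨x, hxA, hgA x hxA⟩
  · exact isSlice_cap_of_ne_zero hA hf hne

theorem IsSCD.exists_isDetermining_cap {A : Set X} (hA : IsSCD A) :
    ∃ (f : ℕ → X →L[ℝ] ℝ) (c : ℕ → ℝ), IsDetermining A fun n => cap A (f n) (c n) := by
  obtain ⟨-, U, hU, hdet⟩ := hA
  choose _ f _ ε _ hUf using hU
  exact ⟨f, fun n => sSup (f n '' A) - ε n, (funext hUf : U = _) ▸ hdet⟩

theorem IsDetermining.isSCD [Nontrivial X] {A : Set X} {f : ℕ → X →L[ℝ] ℝ} {c : ℕ → ℝ}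
    (hdet : IsDetermining A fun n => cap A (f n) (c n)) (hA : IsBounded A) : IsSCD A :=
  ⟨hA, _, fun n => isSlice_cap hA (hdet.1 n).1, hdet⟩

theorem image_cap (T : Z →L[ℝ] X) (A : Set Z) (g : X →L[ℝ] ℝ) (c : ℝ) :
    T '' cap A (g.comp T) c = cap (T '' A) g c := by
  ext y
  constructor
  · rintro ⟨x, ⟨hxA, hx⟩, rfl⟩
    exact ⟨mem_image_of_mem T hxA, hx⟩
  · rintro ⟨⟨x, hxA, rfl⟩, hx⟩
    exact ⟨x, ⟨hxA, hx⟩, rfl⟩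

theorem image_closure_convexHull_subset (T : Z →L[ℝ] X) (B : Set Z) :
    T '' closure (convexHull ℝ B) ⊆ closure (convexHull ℝ (T '' B)) := by
  have hhull : T '' convexHull ℝ B = convexHull ℝ (T '' B) := (T : Z →ₗ[ℝ] X).image_convexHull B
  exact hhull ▸ image_closure_subset_closure_image T.continuous

theorem preimage_closure_convexHull_image {T : Z →L[ℝ] X} (hT : IsInducing T) (B : Set Z) :
    T ⁻¹' closure (convexHull ℝ (T '' B)) = closure (convexHull ℝ B) := by
  have hhull : T '' convexHull ℝ B = convexHull ℝ (T '' B) := (T : Z →ₗ[ℝ] X).image_convexHull B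
  rw [← hhull, ← hT.closure_eq_preimage_closure_image]

theorem IsDetermining.image {A : Set Z} {U : ℕ → Set Z} (hU : IsDetermining A U) (T : Z →L[ℝ] X) :
    IsDetermining (T '' A) fun n => T '' U n := by
  refine ⟨fun n => ⟨(hU.1 n).1.image T, image_mono (hU.1 n).2⟩, fun B hB => ?_⟩
  have hpre : ∀ n, (T ⁻¹' B ∩ U n).Nonempty := fun n => by
    obtain ⟨_, hyB, x, hx, rfl⟩ := hB n
    exact ⟨x, hyB, hx⟩
  calc T '' A ⊆ T '' closure (convexHull ℝ (T ⁻¹' B)) := image_mono (hU.2 _ hpre)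
    _ ⊆ closure (convexHull ℝ (T '' (T ⁻¹' B))) := image_closure_convexHull_subset T _
    _ ⊆ closure (convexHull ℝ B) := closure_mono (convexHull_mono (image_preimage_subset T B))

theorem IsDetermining.of_image {A : Set Z} {U : ℕ → Set Z} {T : Z →L[ℝ] X} (hT : IsEmbedding T)
    (hU : IsDetermining (T '' A) fun n => T '' U n) : IsDetermining A U := by
  refine ⟨fun n => ⟨image_nonempty.1 (hU.1 n).1,
    (image_subset_image_iff hT.injective).1 (hU.1 n).2⟩, fun B hB => ?_⟩
  have hhull := hU.2 (T '' B) fun n => (image_inter hT.injective) ▸ (hB n).image T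
  rwa [image_subset_iff, preimage_closure_convexHull_image hT.isInducing] at hhull

theorem exists_comp_eq_of_isEmbedding {T : Z →L[ℝ] X} (hT : IsEmbedding T) (f : Z →L[ℝ] ℝ) :
    ∃ g : X →L[ℝ] ℝ, g.comp T = f := by
  let e := LinearEquiv.ofInjective (T : Z →ₗ[ℝ] X) hT.injective
  have hTe : T ∘ e.symm = Subtype.val :=
    funext fun y => congrArg Subtype.val (e.apply_symm_apply y)
  have he : Continuous e.symm := hT.isInducing.continuous_iff.2 (hTe ▸ continuous_subtype_val)
  obtain ⟨g, hg⟩ := StrongDual.exists_extension (LinearMap.range (T : Z →ₗ[ℝ] X))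
    (f.comp (⟨e.symm, he⟩ : _ →L[ℝ] Z))
  refine ⟨g, ContinuousLinearMap.ext fun z => (hg (e z)).trans ?_⟩
  exact congrArg f (e.symm_apply_apply z)

theorem isSCD_image_iff [Nontrivial Z] {T : Z →L[ℝ] X} (hT : IsEmbedding T) {A : Set Z} :
    IsSCD (T '' A) ↔ IsSCD A := by
  have : Nontrivial X := hT.injective.nontrivial
  constructor
  · intro hTA
    obtain ⟨f, c, hdet⟩ := hTA.exists_isDetermining_cap
    obtain ⟨K, hK⟩ := T.antilipschitz_of_isEmbedding hT
    simp only [← image_cap] at hdet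
    exact (hdet.of_image hT).isSCD
      ((hK.isBounded_preimage hTA.1).subset (subset_preimage_image T A))
  · intro hA
    obtain ⟨f, c, hdet⟩ := hA.exists_isDetermining_cap
    choose g hg using fun n => exists_comp_eq_of_isEmbedding hT (f n)
    simp only [← hg] at hdet
    exact IsDetermining.isSCD (by simpa only [image_cap] using hdet.image T)
      (T.lipschitz.isBounded_image hA.1)

theorem IsSymmetricConvexClosedBounded.image {A : Set Z} (hA : IsSymmetricConvexClosedBounded A)
    {T : Z →L[ℝ] X} (hT : IsClosedEmbedding T) : IsSymmetricConvexClosedBounded (T '' A) where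
  convex := hA.convex.linear_image (T : Z →ₗ[ℝ] X)
  isClosed := hT.isClosedMap _ hA.isClosed
  isBounded := T.lipschitz.isBounded_image hA.isBounded
  neg_mem := by
    rintro _ ⟨x, hx, rfl⟩
    exact ⟨-x, hA.neg_mem x hx, map_neg T x⟩

end Caps

section DentingPoints

variable {X : Type*} [NormedAddCommGroup X] [NormedSpace ℝ X]

/-- `p` is a denting point of `A`: it lies in caps of `A` contained in arbitrarily small balls
around `p`. -/
def IsDentingPoint (A : Set X) (p : X) : Prop :=
  ∀ r > 0, ∃ (f : X →L[ℝ] ℝ) (c : ℝ), p ∈ cap A f c ∧ cap A f c ⊆ ball p r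

theorem isSCD_closure_convexHull_of_isDentingPoint [Nontrivial X] {E : Set X} (hE : E.Countable)
    (hne : E.Nonempty) (hbdd : IsBounded E)
    (h : ∀ p ∈ E, IsDentingPoint (closure (convexHull ℝ E)) p) :
    IsSCD (closure (convexHull ℝ E)) := by
  obtain ⟨p, rfl⟩ := hE.exists_eq_range hne
  choose f c hmem hsub using fun n j : ℕ =>
    h (p n) (mem_range_self n) (1 / ((j : ℝ) + 1)) Nat.one_div_pos_of_nat
  refine IsDetermining.isSCD (f := fun m => f m.unpair.1 m.unpair.2)
    (c := fun m => c m.unpair.1 m.unpair.2)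
    ⟨fun m => ⟨⟨_, hmem _ _⟩, fun x hx => hx.1⟩, fun B hB => ?_⟩
    (isBounded_convexHull.2 hbdd).closure
  refine closure_minimal (convexHull_min ?_ (convex_convexHull ℝ B).closure) isClosed_closure
  rintro _ ⟨n, rfl⟩
  refine closure_mono (subset_convexHull ℝ B) (Metric.mem_closure_iff.2 fun r hr => ?_)
  obtain ⟨j, hj⟩ := exists_nat_one_div_lt hr
  obtain ⟨x, hxB, hx⟩ := hB (Nat.pair n j)
  simp only [Nat.unpair_pair] at hx
  exact ⟨x, hxB, (mem_ball'.1 (hsub n j hx)).trans hj⟩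

theorem norm_sub_add_le_of_mem_closure_convexHull {E : Set X} {p : X} {f : X →L[ℝ] ℝ} {c : ℝ}
    (h : ∀ x ∈ E, ‖x - p‖ + f x ≤ c) {x : X} (hx : x ∈ closure (convexHull ℝ E)) :
    ‖x - p‖ + f x ≤ c := by
  have hconv : ConvexOn ℝ univ fun x => ‖x - p‖ + f x := by
    refine ConvexOn.add ?_ ((f : X →ₗ[ℝ] ℝ).convexOn convex_univ)
    simpa only [dist_eq_norm] using convexOn_univ_dist p
  have hset : Convex ℝ {x | ‖x - p‖ + f x ≤ c} := by
    simpa only [mem_univ, true_and] using hconv.convex_le c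
  have hclosed : IsClosed {x | ‖x - p‖ + f x ≤ c} := isClosed_le (by fun_prop) continuous_const
  exact closure_minimal (convexHull_min h hset) hclosed hx

theorem isDentingPoint_closure_convexHull {E : Set X} (hE : IsBounded E) {p : X} (hp : p ∈ E)
    {f : X →L[ℝ] ℝ} {δ : ℝ} (hδ : 0 < δ) (hf : ∀ x ∈ E, x ≠ p → f x + δ ≤ f p) :
    IsDentingPoint (closure (convexHull ℝ E)) p := by
  intro r hr
  obtain ⟨D, hD, hdist⟩ := Metric.isBounded_iff_exists_ge 1 |>.1 hE
  have hK : 0 < D / δ := by positivity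
  have hbound : ∀ x ∈ E, ‖x - p‖ + (D / δ * f x) ≤ D / δ * f p := fun x hx => by
    rcases eq_or_ne x p with rfl | hxp
    · simp
    · have hD' : ‖x - p‖ ≤ D / δ * δ := by
        rw [div_mul_cancel₀ D hδ.ne', ← dist_eq_norm]
        exact hdist hx hp
      linarith [mul_le_mul_of_nonneg_left (hf x hx hxp) hK.le]
  refine ⟨(D / δ) • f, D / δ * f p - r,
    ⟨subset_closure (subset_convexHull ℝ E hp), sub_lt_self _ hr⟩, fun x ⟨hx, hcx⟩ => ?_⟩
  have hle := norm_sub_add_le_of_mem_closure_convexHull (f := (D / δ) • f) hbound hx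
  rw [mem_ball, dist_eq_norm]
  linarith

theorem isSymmetricConvexClosedBounded_closure_convexHull {E : Set X} (hbdd : IsBounded E)
    (hneg : ∀ x ∈ E, -x ∈ E) :
    IsSymmetricConvexClosedBounded (closure (convexHull ℝ E)) where
  convex := (convex_convexHull ℝ E).closure
  isClosed := isClosed_closure
  isBounded := (isBounded_convexHull.2 hbdd).closure
  neg_mem x hx := by
    have himage : (-ContinuousLinearMap.id ℝ X) '' E ⊆ E := image_subset_iff.2 hneg
    exact closure_mono (convexHull_mono himage)
      (image_closure_convexHull_subset (-ContinuousLinearMap.id ℝ X) E (mem_image_of_mem _ hx))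

end DentingPoints

section AlmostAdditive

variable {X : Type*} [NormedAddCommGroup X] [NormedSpace ℝ X]

/-- The points of norm almost at most `‖z‖` at which the triangle inequality with `x` is almost an
equality. -/
def almostAdditiveSet (x z : X) (ε : ℝ) : Set X :=
  {y | ‖y‖ < ‖z‖ + ε ∧ ‖x‖ + ‖z‖ - ε < ‖x + y‖}

variable (X) in
/-- The reformulation of the Daugavet property by closed convex hulls. It mentions no functionals,
so that it can be passed on to separable subspaces by a closing-off argument. -/
def HasDaugavetHullProperty : Prop :=
  ∀ x z : X, ∀ ε > 0, z ∈ closure (convexHull ℝ (almostAdditiveSet x z ε))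

theorem exists_norm_eq_one_smul_eq [Nontrivial X] (x : X) : ∃ e : X, ‖e‖ = 1 ∧ ‖x‖ • e = x := by
  rcases eq_or_ne x 0 with rfl | hx
  · obtain ⟨e, he⟩ := exists_norm_eq X zero_le_one
    exact ⟨e, he, by simp⟩
  · exact ⟨‖x‖⁻¹ • x, norm_smul_inv_norm hx, smul_inv_smul₀ (norm_ne_zero_iff.2 hx) x⟩

theorem le_norm_smul_add_smul {x u : X} {δ a b : ℝ} (hx : ‖x‖ ≤ 1) (hu : ‖u‖ ≤ 1)
    (h : 2 - δ ≤ ‖x + u‖) (ha : 0 ≤ a) :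
    a + b - max a b * δ ≤ ‖a • x + b • u‖ := by
  have ha' : 0 ≤ max a b - a := sub_nonneg.2 (le_max_left a b)
  have hb' : 0 ≤ max a b - b := sub_nonneg.2 (le_max_right a b)
  have htriangle : max a b * ‖x + u‖ ≤
      ‖a • x + b • u‖ + (max a b - a) * ‖x‖ + (max a b - b) * ‖u‖ := by
    have hsum : max a b • (x + u) =
        a • x + b • u + (max a b - a) • x + (max a b - b) • u := by module
    simpa only [← hsum, norm_smul_of_nonneg ha', norm_smul_of_nonneg hb',
      norm_smul_of_nonneg (ha.trans (le_max_left a b))] using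
      norm_add₃_le (a := a • x + b • u) (b := (max a b - a) • x) (c := (max a b - b) • u)
  linarith [mul_le_mul_of_nonneg_left h (ha.trans (le_max_left a b)),
    mul_le_of_le_one_right ha' hx, mul_le_of_le_one_right hb' hu]

theorem HasDaugavetProperty.exists_lt_apply_lt_norm_add (hX : HasDaugavetProperty X)
    {f : X →L[ℝ] ℝ} (hf : ‖f‖ = 1) {x : X} (hx : ‖x‖ = 1) {δ : ℝ} (hδ : 0 < δ) :
    ∃ u : X, ‖u‖ ≤ 1 ∧ 1 - δ < f u ∧ 2 - δ < ‖x + u‖ := by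
  have hx0 : x ≠ 0 := norm_ne_zero_iff.1 (hx ▸ one_ne_zero)
  have hf0 : f ≠ 0 := norm_ne_zero_iff.1 (hf ▸ one_ne_zero)
  have hnorm := hX (f.smulRight x)
    (by rw [ContinuousLinearMap.range_smulRight_apply hf0]; exact finrank_span_singleton hx0)
  rw [ContinuousLinearMap.norm_smulRight_apply, hf, hx] at hnorm
  obtain ⟨u, hu, hsum⟩ := ContinuousLinearMap.exists_lt_apply_of_lt_opNorm
    (ContinuousLinearMap.id ℝ X + f.smulRight x) (r := 2 - δ / 2) (by rw [hnorm]; linarith)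
  wlog hfu : 0 ≤ f u generalizing u
  · refine this (-u) (by rwa [norm_neg]) ?_ (by rw [map_neg]; linarith)
    rwa [map_neg, norm_neg]
  replace hsum : 2 - δ / 2 < ‖u + f u • x‖ := hsum
  have hfu1 : f u ≤ 1 :=
    (le_abs_self _).trans ((f.le_of_opNorm_le hf.le u).trans (by rw [one_mul]; exact hu.le))
  have hle : ‖u + f u • x‖ ≤ ‖u‖ + f u := by
    simpa only [norm_smul_of_nonneg hfu, hx, mul_one] using norm_add_le u (f u • x)
  have hle' : ‖u + f u • x‖ ≤ ‖x + u‖ + (1 - f u) := by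
    have hdecomp : u + f u • x = x + u - (1 - f u) • x := by module
    simpa only [hdecomp, norm_smul_of_nonneg (sub_nonneg.2 hfu1), hx, mul_one] using
      norm_sub_le (x + u) ((1 - f u) • x)
  exact ⟨u, hu.le, by linarith, by linarith⟩

theorem exists_norm_eq_one_cap_closedBall_subset [Nontrivial X] {φ : X →L[ℝ] ℝ} {c : ℝ}
    (hne : (cap (closedBall 0 1) φ c).Nonempty) :
    ∃ f : X →L[ℝ] ℝ, ‖f‖ = 1 ∧
      ∃ δ > 0, cap (closedBall 0 1) f (1 - δ) ⊆ cap (closedBall 0 1) φ c := by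
  obtain ⟨f, hf, hφ⟩ := exists_norm_eq_one_smul_eq φ
  obtain ⟨z, hz, hcz⟩ := hne
  have hc : c < ‖φ‖ := hcz.trans_le <| (le_abs_self _).trans <|
    φ.unit_le_opNorm z (mem_closedBall_zero_iff.1 hz)
  obtain ⟨δ, hδ, hδc⟩ := exists_pos_mul_lt (sub_pos.2 hc) ‖φ‖
  refine ⟨f, hf, δ, hδ, fun y ⟨hy, hfy⟩ => ⟨hy, ?_⟩⟩
  calc c < ‖φ‖ * (1 - δ) := by linarith
    _ ≤ ‖φ‖ * f y := by gcongr
    _ = φ y := congrArg (fun g : X →L[ℝ] ℝ => g y) hφ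

theorem HasDaugavetProperty.hasDaugavetHullProperty (hX : HasDaugavetProperty X) :
    HasDaugavetHullProperty X := by
  intro x z ε hε
  rcases eq_or_ne z 0 with rfl | hz
  · exact subset_closure (subset_convexHull ℝ _ (by simp [almostAdditiveSet, hε]))
  have : Nontrivial X := ⟨z, 0, hz⟩
  by_contra hcon
  obtain ⟨f, s, hfs, hsz⟩ := geometric_hahn_banach_closed_point
    (convex_convexHull ℝ (almostAdditiveSet x z ε)).closure isClosed_closure hcon
  have hzpos : 0 < ‖z‖ := norm_pos_iff.2 hz
  obtain ⟨g, hg, δ₀, hδ₀, hcap⟩ := exists_norm_eq_one_cap_closedBall_subset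
    (φ := f) (c := s / ‖z‖) ⟨‖z‖⁻¹ • z, by simp [norm_smul, hzpos.ne'], by
      rw [map_smul, smul_eq_mul, div_eq_inv_mul]; gcongr⟩
  obtain ⟨δ₁, hδ₁, hδε⟩ := exists_pos_mul_lt hε (max ‖x‖ ‖z‖)
  obtain ⟨e, he, hxe⟩ := exists_norm_eq_one_smul_eq x
  obtain ⟨u, hu, hgu, heu⟩ := hX.exists_lt_apply_lt_norm_add hg he (lt_min hδ₀ hδ₁)
  have hmem : ‖z‖ • u ∈ almostAdditiveSet x z ε := by
    have hsum := le_norm_smul_add_smul (b := ‖z‖) he.le hu heu.le (norm_nonneg x)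
    have hmax : max ‖x‖ ‖z‖ * min δ₀ δ₁ ≤ max ‖x‖ ‖z‖ * δ₁ := by gcongr; exact min_le_right _ _
    rw [hxe] at hsum
    refine ⟨?_, by linarith⟩
    rw [norm_smul, norm_norm]
    linarith [mul_le_of_le_one_right hzpos.le hu]
  have hfu : s / ‖z‖ < f u :=
    (hcap ⟨mem_closedBall_zero_iff.2 hu, by linarith [min_le_left δ₀ δ₁]⟩).2
  have hle := hfs _ (subset_closure (subset_convexHull ℝ _ hmem))
  rw [map_smul, smul_eq_mul, ← lt_div_iff₀' hzpos] at hle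
  exact lt_asymm hfu hle

end AlmostAdditive

section EllOneOrthogonality

variable {X : Type*} [NormedAddCommGroup X] [NormedSpace ℝ X]

theorem HasDaugavetHullProperty.exists_mem_almostAdditiveSet_lt_apply
    (hX : HasDaugavetHullProperty X) (x z : X) {ε : ℝ} (hε : 0 < ε) {f : X →L[ℝ] ℝ} {c : ℝ}
    (hc : c < f z) : ∃ y ∈ almostAdditiveSet x z ε, c < f y := by
  by_contra! h
  have hsub : closure (convexHull ℝ (almostAdditiveSet x z ε)) ⊆ {y | f y ≤ c} :=
    closure_minimal (convexHull_min h (convex_halfSpace_le f.isLinear _))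
      (isClosed_le f.continuous continuous_const)
  exact hc.not_ge (hsub (hX x z ε hε))

theorem HasDaugavetHullProperty.exists_lt_apply_lt_norm_add (hX : HasDaugavetHullProperty X)
    {f : X →L[ℝ] ℝ} (hf : ‖f‖ = 1) {x : X} (hx : ‖x‖ = 1) {δ : ℝ} (hδ : 0 < δ) :
    ∃ u : X, ‖u‖ ≤ 1 ∧ 1 - δ < f u ∧ 2 - δ < ‖x + u‖ := by
  obtain ⟨e, he, hfe⟩ := f.exists_lt_apply_of_lt_opNorm (r := 1 - δ / 4) (by linarith)
  wlog hfe0 : 0 ≤ f e generalizing e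
  · exact this (-e) (by rwa [norm_neg]) (by rwa [map_neg, norm_neg])
      (by rw [map_neg]; linarith)
  rw [Real.norm_of_nonneg hfe0] at hfe
  obtain ⟨y, ⟨hy, hxy⟩, hfy⟩ :=
    hX.exists_mem_almostAdditiveSet_lt_apply x e (ε := δ / 4) (by positivity) hfe
  have hfe' : f e ≤ ‖e‖ := (le_abs_self _).trans ((f.le_of_opNorm_le hf.le e).trans_eq (one_mul _))
  obtain ⟨u, hu, rfl⟩ : ∃ u : X, ‖u‖ ≤ 1 ∧ u + (δ / 4) • u = y := by
    have hpos : 0 < 1 + δ / 4 := by positivity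
    refine ⟨(1 + δ / 4)⁻¹ • y, ?_, ?_⟩
    · rw [norm_smul_of_nonneg (inv_nonneg.2 hpos.le), inv_mul_le_iff₀ hpos]
      linarith
    · exact (by module : _ = (1 + δ / 4) • (1 + δ / 4)⁻¹ • y).trans (smul_inv_smul₀ hpos.ne' y)
  have hfu : f u ≤ 1 := (le_abs_self _).trans (hf ▸ f.unit_le_opNorm u hu)
  have hxu : ‖x + (u + (δ / 4) • u)‖ ≤ ‖x + u‖ + δ / 4 * ‖u‖ := by
    simpa only [add_assoc, norm_smul_of_nonneg (by positivity : 0 ≤ δ / 4)] using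
      norm_add_le (x + u) ((δ / 4) • u)
  rw [map_add, map_smul, smul_eq_mul] at hfy
  have := mul_le_of_le_one_right (by positivity : 0 ≤ δ / 4) hfu
  have := mul_le_of_le_one_right (by positivity : 0 ≤ δ / 4) hu
  exact ⟨u, hu, by linarith, by linarith⟩

theorem HasDaugavetHullProperty.exists_cap_subset (hX : HasDaugavetHullProperty X)
    {φ : X →L[ℝ] ℝ} {c : ℝ} (hne : (cap (closedBall 0 1) φ c).Nonempty) {x : X} (hx : ‖x‖ = 1)
    {ε : ℝ} (hε : 0 < ε) :
    ∃ (ψ : X →L[ℝ] ℝ) (d : ℝ), (cap (closedBall 0 1) ψ d).Nonempty ∧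
      cap (closedBall 0 1) ψ d ⊆ cap (closedBall 0 1) φ c ∧
      ∀ y ∈ cap (closedBall 0 1) ψ d, 2 - ε ≤ ‖x + y‖ := by
  have hx0 : x ≠ 0 := norm_ne_zero_iff.1 (hx ▸ one_ne_zero)
  have : Nontrivial X := ⟨x, 0, hx0⟩
  obtain ⟨f, hf, δ₀, hδ₀, hcap⟩ := exists_norm_eq_one_cap_closedBall_subset hne
  obtain ⟨δ, hδ, hδδ₀, hδε⟩ : ∃ δ > 0, 2 * δ ≤ δ₀ ∧ 3 * δ ≤ ε :=
    ⟨min (δ₀ / 2) (ε / 3), by positivity, by linarith [min_le_left (δ₀ / 2) (ε / 3)],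
      by linarith [min_le_right (δ₀ / 2) (ε / 3)]⟩
  obtain ⟨v, hv, hfv, hxv⟩ := hX.exists_lt_apply_lt_norm_add hf hx hδ
  obtain ⟨g, hg, hgxv⟩ := exists_dual_vector'' ℝ (x + v)
  have hfle (y : X) (hy : ‖y‖ ≤ 1) : f y ≤ 1 :=
    (le_abs_self _).trans (hf ▸ f.unit_le_opNorm y hy)
  have hgle (y : X) (hy : ‖y‖ ≤ 1) : g y ≤ 1 :=
    (le_abs_self _).trans ((g.unit_le_opNorm y hy).trans hg)
  have hgxv' : g x + g v = ‖x + v‖ := by rw [← map_add, hgxv]; rfl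
  refine ⟨f + g, 2 - 2 * δ, ⟨v, mem_closedBall_zero_iff.2 hv, ?_⟩, fun y ⟨hy, hfgy⟩ => ?_,
    fun y ⟨hy, hfgy⟩ => ?_⟩
  · change 2 - 2 * δ < f v + g v
    linarith [hgle x hx.le]
  · replace hfgy : 2 - 2 * δ < f y + g y := hfgy
    exact hcap ⟨hy, by linarith [hgle y (mem_closedBall_zero_iff.1 hy)]⟩
  · replace hfgy : 2 - 2 * δ < f y + g y := hfgy
    have hgy : g x + g y ≤ ‖x + y‖ := by
      rw [← map_add]
      exact (le_abs_self _).trans ((g.le_of_opNorm_le hg _).trans_eq (one_mul _))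
    linarith [hfle y (mem_closedBall_zero_iff.1 hy), hgle v hv]

theorem HasDaugavetHullProperty.exists_cap_subset_of_finite (hX : HasDaugavetHullProperty X)
    {φ : X →L[ℝ] ℝ} {c : ℝ} (hne : (cap (closedBall 0 1) φ c).Nonempty) {s : Set X}
    (hs : s.Finite) (hs1 : s ⊆ sphere 0 1) {ε : ℝ} (hε : 0 < ε) :
    ∃ (ψ : X →L[ℝ] ℝ) (d : ℝ), (cap (closedBall 0 1) ψ d).Nonempty ∧
      cap (closedBall 0 1) ψ d ⊆ cap (closedBall 0 1) φ c ∧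
      ∀ y ∈ cap (closedBall 0 1) ψ d, ∀ x ∈ s, 2 - ε ≤ ‖x + y‖ := by
  induction s, hs using Set.Finite.induction_on with
  | empty => exact ⟨φ, c, hne, Subset.rfl, fun _ _ _ h => h.elim⟩
  | @insert a s _ _ ih =>
    obtain ⟨ψ, d, hne, hsub, hψ⟩ := ih ((subset_insert a s).trans hs1)
    obtain ⟨ψ', d', hne', hsub', hψ'⟩ :=
      hX.exists_cap_subset hne (mem_sphere_zero_iff_norm.1 (hs1 (mem_insert a s))) hε
    exact ⟨ψ', d', hne', hsub'.trans hsub,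
      fun y hy => forall_mem_insert.2 ⟨hψ' y hy, hψ y (hsub' hy)⟩⟩

theorem HasDaugavetHullProperty.exists_mem_cap_le_norm_add_of_isCompact
    (hX : HasDaugavetHullProperty X) {φ : X →L[ℝ] ℝ} {c : ℝ}
    (hne : (cap (closedBall 0 1) φ c).Nonempty) {s : Set X} (hs : IsCompact s)
    (hs1 : s ⊆ sphere 0 1) {ε : ℝ} (hε : 0 < ε) :
    ∃ b ∈ cap (closedBall 0 1) φ c, ∀ x ∈ s, 2 - ε ≤ ‖x + b‖ := by
  obtain ⟨N, hNs, hN, hcover⟩ := hs.finite_cover_balls (half_pos hε)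
  obtain ⟨ψ, d, ⟨b, hb⟩, hsub, hψ⟩ :=
    hX.exists_cap_subset_of_finite hne hN (hNs.trans hs1) (half_pos hε)
  refine ⟨b, hsub hb, fun x hx => ?_⟩
  obtain ⟨x', hx', hxx'⟩ := mem_iUnion₂.1 (hcover hx)
  rw [mem_ball', dist_eq_norm] at hxx'
  have htriangle : ‖x' + b‖ ≤ ‖x + b‖ + ‖x' - x‖ := by
    have hdecomp : x' + b = x + b + (x' - x) := by abel
    exact hdecomp ▸ norm_add_le (x + b) (x' - x)
  linarith [hψ b hb x' hx']

theorem mul_norm_le_norm_add_smul_of_forall_norm_eq_one {F : Submodule ℝ X} {b : X} (hb : ‖b‖ ≤ 1)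
    {ε : ℝ} (hε : ε ≤ 1) (h : ∀ e ∈ F, ‖e‖ = 1 → 2 - ε ≤ ‖e + b‖) {w : X} (hw : w ∈ F) (t : ℝ) :
    (1 - ε) * ‖w‖ ≤ ‖w + t • b‖ := by
  wlog ht : 0 ≤ t generalizing w t
  · have hneg := this (F.neg_mem hw) (-t) (by linarith)
    rwa [norm_neg, neg_smul, ← neg_add, norm_neg] at hneg
  rcases eq_or_ne w 0 with rfl | hw0
  · simp
  have he : ‖‖w‖⁻¹ • w‖ = 1 := norm_smul_inv_norm hw0
  have hsum := le_norm_smul_add_smul (b := t) he.le hb (h _ (F.smul_mem _ hw) he) (norm_nonneg w)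
  rw [smul_inv_smul₀ (norm_ne_zero_iff.2 hw0)] at hsum
  refine le_trans ?_ hsum
  rcases le_total ‖w‖ t with hwt | hwt
  · rw [max_eq_right hwt]
    linarith [mul_le_mul_of_nonneg_left hwt (sub_nonneg.2 hε), norm_nonneg w]
  · rw [max_eq_left hwt]
    linarith

theorem HasDaugavetHullProperty.exists_mem_cap_mul_norm_le (hX : HasDaugavetHullProperty X)
    {φ : X →L[ℝ] ℝ} {c : ℝ} (hne : (cap (closedBall 0 1) φ c).Nonempty) (F : Submodule ℝ X)
    [FiniteDimensional ℝ F] {κ : ℝ} (hκ0 : 0 ≤ κ) (hκ : κ < 1) :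
    ∃ b ∈ cap (closedBall 0 1) φ c, ∀ w ∈ F, ∀ t : ℝ, κ * ‖w‖ ≤ ‖w + t • b‖ := by
  have : ProperSpace F := FiniteDimensional.proper ℝ F
  obtain ⟨b, hb, hFb⟩ := hX.exists_mem_cap_le_norm_add_of_isCompact hne
    ((isCompact_sphere (0 : F) 1).image continuous_subtype_val)
    (image_subset_iff.2 fun e he => by simpa using he) (sub_pos.2 hκ)
  refine ⟨b, hb, fun w hw t => ?_⟩
  have hle := mul_norm_le_norm_add_smul_of_forall_norm_eq_one (mem_closedBall_zero_iff.1 hb.1)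
    (sub_le_self 1 hκ0) (fun e he he1 => hFb e ⟨⟨e, he⟩, by simpa using he1, rfl⟩) hw t
  rwa [sub_sub_cancel] at hle

theorem HasDaugavetHullProperty.not_finiteDimensional [Nontrivial X]
    (hX : HasDaugavetHullProperty X) : ¬ FiniteDimensional ℝ X := by
  intro _
  obtain ⟨z, hz⟩ := exists_norm_eq X zero_le_one
  obtain ⟨g, -, hgz⟩ := exists_dual_vector'' ℝ z
  obtain ⟨b, ⟨-, hgb⟩, hb⟩ := hX.exists_mem_cap_mul_norm_le (φ := g) (c := 0)
    ⟨z, by simp [hz], by simp [hgz, hz]⟩ ⊤ (κ := 1 / 2) (by norm_num) (by norm_num)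
  have hb0 : b ≠ 0 := by
    rintro rfl
    simp at hgb
  have hle := hb b trivial (-1)
  rw [neg_one_smul, add_neg_cancel, norm_zero] at hle
  linarith [norm_pos_iff.2 hb0]

theorem HasDaugavetHullProperty.exists_mem_cap_mul_infDist_le (hX : HasDaugavetHullProperty X)
    {φ : X →L[ℝ] ℝ} {c : ℝ} (hne : (cap (closedBall 0 1) φ c).Nonempty) (H : Submodule ℝ X)
    [FiniteDimensional ℝ H] (x₀ : X) {κ : ℝ} (hκ0 : 0 ≤ κ) (hκ : κ < 1) :
    ∃ b ∈ cap (closedBall 0 1) φ c,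
      κ * infDist x₀ H ≤ infDist x₀ (H ⊔ ℝ ∙ b : Submodule ℝ X) := by
  obtain ⟨b, hb, hle⟩ := hX.exists_mem_cap_mul_norm_le hne (H ⊔ ℝ ∙ x₀) hκ0 hκ
  refine ⟨b, hb, (le_infDist ⟨0, Submodule.zero_mem _⟩).2 fun y hy => ?_⟩
  obtain ⟨u, hu, v, hv, rfl⟩ := Submodule.mem_sup.1 hy
  obtain ⟨t, rfl⟩ := Submodule.mem_span_singleton.1 hv
  have hmem : x₀ - u ∈ H ⊔ ℝ ∙ x₀ := Submodule.sub_mem _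
    (Submodule.mem_sup_right (Submodule.mem_span_singleton_self x₀)) (Submodule.mem_sup_left hu)
  calc κ * infDist x₀ H ≤ κ * dist x₀ u := by gcongr; exact infDist_le_dist_of_mem hu
    _ = κ * ‖x₀ - u‖ := by rw [dist_eq_norm]
    _ ≤ ‖x₀ - u + (-t) • b‖ := hle _ hmem (-t)
    _ = dist x₀ (u + t • b) := by rw [dist_eq_norm]; congr 1; module

theorem HasDaugavetHullProperty.exists_seq_submodule_mul_infDist_le
    (hX : HasDaugavetHullProperty X) {φ : ℕ → X →L[ℝ] ℝ} {c : ℕ → ℝ}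
    (hne : ∀ n, (cap (closedBall 0 1) (φ n) (c n)).Nonempty) (K : Submodule ℝ X)
    [FiniteDimensional ℝ K] (x₀ : X) {κ : ℕ → ℝ} (hκ0 : ∀ n, 0 ≤ κ n) (hκ : ∀ n, κ n < 1) :
    ∃ (a : ℕ → X) (H : ℕ → Submodule ℝ X), (∀ n, a n ∈ cap (closedBall 0 1) (φ n) (c n)) ∧
      H 0 = K ∧ (∀ n, H (n + 1) = H n ⊔ ℝ ∙ a n) ∧
      ∀ n, κ n * infDist x₀ (H n) ≤ infDist x₀ (H (n + 1)) := by
  have hstep (n : ℕ) (H : {H : Submodule ℝ X // FiniteDimensional ℝ H}) :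
      ∃ b ∈ cap (closedBall 0 1) (φ n) (c n),
        κ n * infDist x₀ H.1 ≤ infDist x₀ (H.1 ⊔ ℝ ∙ b : Submodule ℝ X) :=
    have := H.2
    hX.exists_mem_cap_mul_infDist_le (hne n) H.1 x₀ (hκ0 n) (hκ n)
  choose b hb hle using hstep
  let H : ℕ → {H : Submodule ℝ X // FiniteDimensional ℝ H} := fun n =>
    n.rec ⟨K, inferInstance⟩ fun n H => ⟨H.1 ⊔ ℝ ∙ b n H, have := H.2; inferInstance⟩
  exact ⟨fun n => b n (H n), fun n => (H n).1, fun n => hb n (H n), rfl, fun _ => rfl,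
    fun n => hle n (H n)⟩

theorem HasDaugavetHullProperty.exists_seq_mem_cap_mul_infDist_le (hX : HasDaugavetHullProperty X)
    {φ : ℕ → X →L[ℝ] ℝ} {c : ℕ → ℝ} (hne : ∀ n, (cap (closedBall 0 1) (φ n) (c n)).Nonempty)
    (K : Submodule ℝ X) [FiniteDimensional ℝ K] (x₀ : X) {κ : ℝ} (hκ0 : 0 ≤ κ) (hκ : κ < 1) :
    ∃ a : ℕ → X, (∀ n, a n ∈ cap (closedBall 0 1) (φ n) (c n)) ∧
      κ * infDist x₀ K ≤ infDist x₀ (K ⊔ Submodule.span ℝ (range a) : Submodule ℝ X) := by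
  -- Weights decreasing from `1` to `κ`; the `n`-th step may lose the factor `w (n + 1) / w n`.
  let w : ℕ → ℝ := fun n => κ + (1 - κ) / ((n : ℝ) + 1)
  have hκ' : 0 < 1 - κ := sub_pos.2 hκ
  have hw (n : ℕ) : 0 < w n := by positivity
  have hκw (n : ℕ) : κ ≤ w n := le_add_of_nonneg_right (div_nonneg hκ'.le (by positivity))
  have hanti (n : ℕ) : w (n + 1) < w n := by
    simp only [w]
    gcongr
    exact n.lt_succ_self
  obtain ⟨a, H, ha, rfl, hH, hle⟩ := hX.exists_seq_submodule_mul_infDist_le hne K x₀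
    (fun n => div_nonneg (hw (n + 1)).le (hw n).le) fun n => (div_lt_one (hw n)).2 (hanti n)
  have hmono : Monotone H := monotone_nat_of_le_succ fun n => hH n ▸ le_sup_left
  have hdist (n : ℕ) : w n * infDist x₀ (H 0) ≤ infDist x₀ (H n) := by
    induction n with
    | zero => simp [w]
    | succ n ih =>
      calc w (n + 1) * infDist x₀ (H 0) = w (n + 1) / w n * (w n * infDist x₀ (H 0)) := by
            rw [← mul_assoc, div_mul_cancel₀ _ (hw n).ne']
        _ ≤ w (n + 1) / w n * infDist x₀ (H n) := by gcongr
        _ ≤ infDist x₀ (H (n + 1)) := hle n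
  have hspan : H 0 ⊔ Submodule.span ℝ (range a) ≤ ⨆ n, H n := by
    refine sup_le (le_iSup H 0) (Submodule.span_le.2 ?_)
    rintro _ ⟨n, rfl⟩
    refine le_iSup H (n + 1) ?_
    exact hH n ▸ Submodule.mem_sup_right (Submodule.mem_span_singleton_self _)
  refine ⟨a, ha, (le_infDist ⟨0, Submodule.zero_mem _⟩).2 fun y hy => ?_⟩
  obtain ⟨n, hn⟩ := (Submodule.mem_iSup_of_directed _ hmono.directed_le).1 (hspan hy)
  calc κ * infDist x₀ (H 0) ≤ w n * infDist x₀ (H 0) :=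
        mul_le_mul_of_nonneg_right (hκw n) infDist_nonneg
    _ ≤ infDist x₀ (H n) := hdist n
    _ ≤ dist x₀ y := infDist_le_dist_of_mem hn

end EllOneOrthogonality

section Quotients

variable {X E : Type*} [NormedAddCommGroup X] [NormedSpace ℝ X] [NormedAddCommGroup E]
  [NormedSpace ℝ E] (G : Submodule ℝ X)

theorem mem_closure_of_mkQL_mem_closure_image {V : Submodule ℝ X} (hGV : G ≤ V) {x : X}
    (hx : G.mkQL x ∈ closure (G.mkQL '' V)) : x ∈ closure (V : Set X) := by
  have hpre : G.mkQL ⁻¹' (G.mkQL '' V) = V :=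
    congrArg (SetLike.coe : _ → Set X) ((Submodule.comap_map_mkQ G V).trans (sup_eq_right.2 hGV))
  have hopen : IsOpenMap G.mkQL := G.isOpenMap_mkQ
  rwa [← hpre, ← hopen.preimage_closure_eq_closure_preimage G.mkQL.continuous]

variable [IsClosed (G : Set X)]

theorem nonempty_cap_closedBall_comp_mkQL {φ : (X ⧸ G) →L[ℝ] ℝ} {c : ℝ}
    (hne : (cap (closedBall 0 1) φ c).Nonempty) :
    (cap (closedBall 0 1) (φ.comp G.mkQL) c).Nonempty := by
  have hopen : IsOpen {q | c < φ q} := isOpen_lt continuous_const φ.continuous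
  obtain ⟨q, hq, hcq⟩ := hne
  rw [← closure_ball (0 : X ⧸ G) one_ne_zero] at hq
  obtain ⟨q', hcq', hq'⟩ := mem_closure_iff.1 hq _ hopen hcq
  obtain ⟨x, rfl, hx⟩ := QuotientAddGroup.norm_lt_iff.1 (mem_ball_zero_iff.1 hq')
  exact ⟨x, mem_closedBall_zero_iff.2 hx.le, hcq'⟩

theorem HasDaugavetHullProperty.exists_seq_mem_cap_quotient_notMem_closure_span
    (hX : HasDaugavetHullProperty X) [FiniteDimensional ℝ G] {φ : ℕ → (X ⧸ G) →L[ℝ] ℝ} {c : ℕ → ℝ}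
    (hne : ∀ n, (cap (closedBall 0 1) (φ n) (c n)).Nonempty) {q : X ⧸ G} (hq : q ≠ 0) :
    ∃ b : ℕ → X ⧸ G, (∀ n, b n ∈ cap (closedBall 0 1) (φ n) (c n)) ∧
      q ∉ closure (Submodule.span ℝ (range b) : Set (X ⧸ G)) := by
  obtain ⟨x, rfl⟩ : ∃ x, G.mkQL x = q := G.mkQ_surjective q
  obtain ⟨a, ha, hdist⟩ := hX.exists_seq_mem_cap_mul_infDist_le
    (fun n => nonempty_cap_closedBall_comp_mkQL G (hne n)) G x (κ := 1 / 2)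
    (by norm_num) (by norm_num)
  have hnorm (n : ℕ) : ‖G.mkQL (a n)‖ ≤ 1 :=
    (QuotientAddGroup.norm_mk_le_norm (m := a n)).trans (mem_closedBall_zero_iff.1 (ha n).1)
  refine ⟨fun n => G.mkQL (a n), fun n => ⟨mem_closedBall_zero_iff.2 (hnorm n), (ha n).2⟩,
    fun hmem => ?_⟩
  let V : Submodule ℝ X := G ⊔ Submodule.span ℝ (range a)
  have hspan : Submodule.span ℝ (range fun n => G.mkQL (a n)) ≤ V.map G.mkQ :=
    Submodule.span_le.2 (range_subset_iff.2 fun n =>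
      Submodule.mem_map_of_mem (Submodule.mem_sup_right (Submodule.subset_span ⟨n, rfl⟩)))
  have hx : x ∈ closure (V : Set X) :=
    mem_closure_of_mkQL_mem_closure_image G le_sup_left (closure_mono hspan hmem)
  rw [mem_closure_iff_infDist_zero ⟨0, V.zero_mem⟩] at hx
  have hG : ‖G.mkQL x‖ = infDist x G := QuotientAddGroup.norm_mk x
  linarith [norm_pos_iff.2 hq]

theorem HasDaugavetHullProperty.not_isSCD_closedBall_quotient_prod
    (hX : HasDaugavetHullProperty X) [FiniteDimensional ℝ G] [Nontrivial (X ⧸ G)] (K : Set E) :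
    ¬ IsSCD (closedBall (0 : X ⧸ G) 1 ×ˢ K) := by
  intro hSCD
  obtain ⟨f, c, hdet⟩ := hSCD.exists_isDetermining_cap
  choose p hp using fun n => (hdet.1 n).1
  let φ : ℕ → (X ⧸ G) →L[ℝ] ℝ := fun n => (f n).comp (ContinuousLinearMap.inl ℝ (X ⧸ G) E)
  have hf (n : ℕ) (q : X ⧸ G) : f n (q, (p n).2) = φ n q + f n (0, (p n).2) := by
    simp [φ, ← map_add]
  have hne (n : ℕ) : (cap (closedBall 0 1) (φ n) (c n - f n (0, (p n).2))).Nonempty := by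
    refine ⟨(p n).1, (hp n).1.1, ?_⟩
    rw [sub_lt_iff_lt_add, ← hf]
    exact (hp n).2
  obtain ⟨q, hq⟩ := exists_norm_eq (X ⧸ G) zero_le_one
  obtain ⟨b, hb, hqb⟩ := hX.exists_seq_mem_cap_quotient_notMem_closure_span G hne
    (norm_ne_zero_iff.1 (hq ▸ one_ne_zero))
  let B : Set ((X ⧸ G) × E) := range fun n => (b n, (p n).2)
  have hB (n : ℕ) : (B ∩ cap (closedBall 0 1 ×ˢ K) (f n) (c n)).Nonempty := by
    refine ⟨_, mem_range_self n, ⟨(hb n).1, (hp n).1.2⟩, ?_⟩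
    rw [hf]
    exact sub_lt_iff_lt_add.1 (hb n).2
  have hmem : (q, (p 0).2) ∈ closure (convexHull ℝ B) :=
    hdet.2 B hB ⟨mem_closedBall_zero_iff.2 hq.le, (hp 0).1.2⟩
  have hfst : Prod.fst '' B ⊆ Submodule.span ℝ (range b) := by
    rintro _ ⟨_, ⟨n, rfl⟩, rfl⟩
    exact Submodule.subset_span (mem_range_self n)
  exact hqb <| closure_mono (convexHull_min hfst (Submodule.convex _))
    (image_closure_convexHull_subset (ContinuousLinearMap.fst ℝ (X ⧸ G) E) B ⟨_, hmem, rfl⟩)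

end Quotients

section SeparableSubspaces

open TopologicalSpace

variable {X : Type*} [NormedAddCommGroup X]

theorem almostAdditiveSet_subset {x x' z z' : X} {δ : ℝ} (hx : ‖x - x'‖ ≤ δ) (hz : ‖z - z'‖ ≤ δ)
    (ε : ℝ) : almostAdditiveSet x' z' ε ⊆ almostAdditiveSet x z (ε + 3 * δ) := by
  rintro y ⟨hy, hxy⟩
  have hzz' := abs_le.1 ((abs_norm_sub_norm_le z z').trans hz)
  have hxx' := abs_le.1 ((abs_norm_sub_norm_le x x').trans hx)
  have hsum := abs_le.1 ((abs_norm_sub_norm_le (x + y) (x' + y)).trans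
    ((congrArg norm (add_sub_add_right_eq_sub x x' y)).trans_le hx))
  exact ⟨by linarith, by linarith⟩

variable [NormedSpace ℝ X]

/-- The Daugavet hull property for points of `S`, witnessed by almost additive points of `N`; for
`S` and `N` equal to a subspace `M` this is the Daugavet hull property of `M`. -/
def DaugavetHullOn (S N : Set X) : Prop :=
  ∀ x ∈ S, ∀ z ∈ S, ∀ ε > 0, z ∈ closure (convexHull ℝ (almostAdditiveSet x z ε ∩ N))

theorem DaugavetHullOn.mono_right {S N N' : Set X} (h : DaugavetHullOn S N) (hN : N ⊆ N') :
    DaugavetHullOn S N' := fun x hx z hz ε hε =>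
  closure_mono (convexHull_mono (inter_subset_inter_right _ hN)) (h x hx z hz ε hε)

theorem DaugavetHullOn.closure_left {S N : Set X} (h : DaugavetHullOn S N) :
    DaugavetHullOn (closure S) N := by
  intro x hx z hz ε hε
  rw [← closure_closure, Metric.mem_closure_iff]
  intro r hr
  obtain ⟨x', hx', hxx'⟩ := Metric.mem_closure_iff.1 hx (ε / 4) (by positivity)
  obtain ⟨z', hz', hzz'⟩ := Metric.mem_closure_iff.1 hz (min (ε / 4) r) (by positivity)
  rw [dist_eq_norm] at hxx'
  have hsub : almostAdditiveSet x' z' (ε / 4) ⊆ almostAdditiveSet x z ε := by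
    convert almostAdditiveSet_subset hxx'.le
      (dist_eq_norm z z' ▸ (hzz'.trans_le (min_le_left _ _)).le) (ε / 4) using 1
    ring_nf
  exact ⟨z', closure_mono (convexHull_mono (inter_subset_inter_left _ hsub))
    (h x' hx' z' hz' (ε / 4) (by positivity)), hzz'.trans_le (min_le_right _ _)⟩

theorem exists_countable_subset_mem_closure_convexHull {s : Set X} {z : X}
    (hz : z ∈ closure (convexHull ℝ s)) :
    ∃ t ⊆ s, t.Countable ∧ z ∈ closure (convexHull ℝ t) := by
  obtain ⟨u, hu, hlim⟩ := mem_closure_iff_seq_limit.1 hz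
  simp only [convexHull_eq_union_convexHull_finite_subsets s, mem_iUnion, exists_prop] at hu
  choose t hts hut using hu
  refine ⟨⋃ n, (t n : Set X), iUnion_subset hts,
    countable_iUnion fun n => (t n).countable_toSet, ?_⟩
  exact mem_closure_of_tendsto hlim (Eventually.of_forall fun n =>
    convexHull_mono (subset_iUnion (fun n => (t n : Set X)) n) (hut n))

theorem HasDaugavetHullProperty.exists_countable_daugavetHullOn (hX : HasDaugavetHullProperty X)
    {S : Set X} (hS : S.Countable) : ∃ N : Set X, N.Countable ∧ DaugavetHullOn S N := by
  choose T hTsub hTc hT using fun (x z : X) (n : ℕ) =>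
    exists_countable_subset_mem_closure_convexHull
      (hX x z (1 / ((n : ℝ) + 1)) Nat.one_div_pos_of_nat)
  refine ⟨⋃ x ∈ S, ⋃ z ∈ S, ⋃ n, T x z n, hS.biUnion fun x _ => hS.biUnion fun z _ =>
    countable_iUnion fun n => hTc x z n, fun x hx z hz ε hε => ?_⟩
  obtain ⟨n, hn⟩ := exists_nat_one_div_lt hε
  refine closure_mono (convexHull_mono (subset_inter (fun y hy => ?_) fun y hy => ?_)) (hT x z n)
  · obtain ⟨hy₁, hy₂⟩ := hTsub x z n hy
    exact ⟨by linarith, by linarith⟩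
  · simp only [mem_iUnion, exists_prop]
    exact ⟨x, hx, z, hz, n, hy⟩

theorem HasDaugavetHullProperty.exists_le_isSeparable_daugavetHullOn
    (hX : HasDaugavetHullProperty X) {M : Submodule ℝ X} (hM : IsSeparable (M : Set X)) :
    ∃ M' : Submodule ℝ X, IsSeparable (M' : Set X) ∧ M ≤ M' ∧ DaugavetHullOn (M : Set X) M' := by
  obtain ⟨S, -, hS, hMS⟩ := hM.exists_countable_dense_subset
  obtain ⟨N, hN, hSN⟩ := hX.exists_countable_daugavetHullOn hS
  refine ⟨M ⊔ Submodule.span ℝ N, ?_, le_sup_left, fun x hx z hz => ?_⟩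
  · rw [← Submodule.span_eq M, ← Submodule.span_union]
    exact (hM.union hN.isSeparable).span
  · have hNM : N ⊆ (M ⊔ Submodule.span ℝ N : Submodule ℝ X) :=
      Submodule.subset_span.trans (le_sup_right : _ ≤ M ⊔ Submodule.span ℝ N)
    exact hSN.closure_left.mono_right hNM x (hMS hx) z (hMS hz)

theorem daugavetHullOn_iSup {M : ℕ → Submodule ℝ X} (hM : Monotone M)
    (h : ∀ n, DaugavetHullOn (M n : Set X) (M (n + 1))) :
    DaugavetHullOn ((⨆ n, M n : Submodule ℝ X) : Set X) (⨆ n, M n : Submodule ℝ X) := by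
  intro x hx z hz
  obtain ⟨k, hk⟩ := (Submodule.mem_iSup_of_directed M hM.directed_le).1 hx
  obtain ⟨l, hl⟩ := (Submodule.mem_iSup_of_directed M hM.directed_le).1 hz
  exact (h (max k l)).mono_right (le_iSup M (max k l + 1)) x (hM (le_max_left k l) hk) z
    (hM (le_max_right k l) hl)

theorem DaugavetHullOn.hasDaugavetHullProperty {M : Submodule ℝ X}
    (hM : DaugavetHullOn (M : Set X) M) : HasDaugavetHullProperty M := by
  intro x z ε hε
  have himage : M.subtypeL '' almostAdditiveSet x z ε = almostAdditiveSet (x : X) z ε ∩ M := by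
    ext y
    constructor
    · rintro ⟨y, hy, rfl⟩
      exact ⟨hy, y.2⟩
    · rintro ⟨hy, hyM⟩
      exact ⟨⟨y, hyM⟩, hy, rfl⟩
  have hmem : (z : X) ∈ closure (convexHull ℝ (M.subtypeL '' almostAdditiveSet x z ε)) :=
    himage ▸ hM x x.2 z z.2 ε hε
  rwa [← preimage_closure_convexHull_image (T := M.subtypeL) IsInducing.subtypeVal]

theorem HasDaugavetHullProperty.exists_isSeparable_submodule (hX : HasDaugavetHullProperty X)
    {M₀ : Submodule ℝ X} (hM₀ : IsSeparable (M₀ : Set X)) :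
    ∃ M : Submodule ℝ X, M₀ ≤ M ∧ IsClosed (M : Set X) ∧ IsSeparable (M : Set X) ∧
      HasDaugavetHullProperty M := by
  choose! enlarge hsep hle hnext using fun (M : Submodule ℝ X) (hM : IsSeparable (M : Set X)) =>
    hX.exists_le_isSeparable_daugavetHullOn hM
  let M : ℕ → Submodule ℝ X := fun n => enlarge^[n] M₀
  have hsucc (n : ℕ) : M (n + 1) = enlarge (M n) := Function.iterate_succ_apply' _ _ _
  have hMsep (n : ℕ) : IsSeparable (M n : Set X) := by
    induction n with
    | zero => exact hM₀
    | succ n ih => exact hsucc n ▸ hsep _ ih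
  have hmono : Monotone M := monotone_nat_of_le_succ fun n => hsucc n ▸ hle _ (hMsep n)
  have hhull : DaugavetHullOn ((⨆ n, M n).topologicalClosure : Set X)
      (⨆ n, M n).topologicalClosure := by
    rw [Submodule.topologicalClosure_coe]
    exact (daugavetHullOn_iSup hmono fun n =>
      hsucc n ▸ hnext _ (hMsep n)).closure_left.mono_right subset_closure
  refine ⟨_, (le_iSup M 0).trans (Submodule.le_topologicalClosure _),
    Submodule.isClosed_topologicalClosure _, ?_, hhull.hasDaugavetHullProperty⟩
  rw [Submodule.topologicalClosure_coe, Submodule.coe_iSup_of_directed _ hmono.directed_le]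
  exact (IsSeparable.iUnion hMsep).closure

end SeparableSubspaces

section Spikes

theorem exists_seq_forall_mapClusterPt (α : Type*) [TopologicalSpace α]
    [TopologicalSpace.SeparableSpace α] [Nonempty α] :
    ∃ y : ℕ → α, ∀ a, MapClusterPt a atTop y := by
  refine ⟨fun n => TopologicalSpace.denseSeq α n.unpair.1, fun a => ?_⟩
  refine mapClusterPt_iff_frequently.2 fun U hU => frequently_atTop.2 fun N => ?_
  obtain ⟨_, hyU, k, rfl⟩ :=
    mem_closure_iff_nhds.1 (TopologicalSpace.denseRange_denseSeq α a) U hU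
  exact ⟨Nat.pair k N, Nat.right_le_pair k N, by simpa only [Nat.unpair_pair] using hyU⟩

theorem norm_eq_of_mem_pair_neg {E : Type*} [SeminormedAddGroup E] {a b : E}
    (h : b ∈ ({a, -a} : Set E)) : ‖b‖ = ‖a‖ := by
  rcases h with rfl | rfl
  · rfl
  · exact norm_neg a

theorem neg_mem_pair_neg {E : Type*} [InvolutiveNeg E] {a b : E} (h : b ∈ ({a, -a} : Set E)) :
    -b ∈ ({a, -a} : Set E) := by
  rcases h with rfl | rfl <;> simp

theorem eq_or_eq_neg_of_mem_pair_neg {E : Type*} [InvolutiveNeg E] {a b c : E}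
    (hb : b ∈ ({a, -a} : Set E)) (hc : c ∈ ({a, -a} : Set E)) : b = c ∨ b = -c := by
  rcases hb with rfl | rfl <;> rcases hc with rfl | rfl <;> simp

theorem apply_le_norm_of_norm_le_one {E : Type*} [SeminormedAddCommGroup E] [NormedSpace ℝ E]
    {g : E →L[ℝ] ℝ} (hg : ‖g‖ ≤ 1) (v : E) : g v ≤ ‖v‖ := by
  simpa only [one_mul] using (le_abs_self _).trans (g.le_of_opNorm_le hg v)

/-- The excess height `2 ^ (-(n + 1))` of the `n`-th layer of spikes. -/
noncomputable def spikeHeight (n : ℕ) : ℝ := (1 / 2) ^ (n + 1)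

theorem spikeHeight_pos (n : ℕ) : 0 < spikeHeight n := by
  unfold spikeHeight
  positivity

theorem spikeHeight_le_half (n : ℕ) : spikeHeight n ≤ 1 / 2 := by
  simpa only [spikeHeight, zero_add, pow_one] using
    pow_le_pow_of_le_one (by norm_num) (by norm_num : (1 / 2 : ℝ) ≤ 1) (Nat.le_add_left 1 n)

theorem spikeHeight_le_half_mul {m n : ℕ} (h : m < n) : spikeHeight n ≤ spikeHeight m / 2 := by
  calc spikeHeight n ≤ (1 / 2) ^ (m + 1 + 1) :=
      pow_le_pow_of_le_one (by norm_num) (by norm_num) (Nat.succ_le_succ h)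
    _ = spikeHeight m / 2 := by rw [pow_succ, mul_one_div, spikeHeight]

theorem sq_spikeHeight_div_four_le {m n : ℕ} (h : m ≠ n) :
    spikeHeight n ^ 2 / 4 ≤ (spikeHeight m - spikeHeight n) ^ 2 := by
  rw [(by ring : spikeHeight n ^ 2 / 4 = (spikeHeight n / 2) ^ 2)]
  refine sq_le_sq.2 ?_
  rw [abs_of_pos (half_pos (spikeHeight_pos n)), le_abs']
  rcases h.lt_or_gt with h | h
  · exact Or.inr (by linarith [spikeHeight_le_half_mul h, spikeHeight_pos m])
  · exact Or.inl (by linarith [spikeHeight_le_half_mul h, spikeHeight_pos n])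

theorem tendsto_spikeHeight : Tendsto spikeHeight atTop (𝓝 0) :=
  (tendsto_add_atTop_iff_nat 1).2
    (tendsto_pow_atTop_nhds_zero_of_lt_one (by norm_num) (by norm_num))

variable {F : Type*} [NormedAddCommGroup F] [NormedSpace ℝ F]

/-- The eight vertices `(± (1 - u ^ 2) • x, ± (1 + u), ± 1)`: those of the unit box over `± x`,
pushed out by `u` in the second coordinate and pulled in by `u ^ 2` in the first one. As `u` varies,
these two coordinates run along a strictly concave parabola, so that different layers are
exposed. -/
def spikeLayer (x : F) (u : ℝ) : Set (F × ℝ × ℝ) :=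
  {(1 - u ^ 2) • x, -((1 - u ^ 2) • x)} ×ˢ {1 + u, -(1 + u)} ×ˢ {1, -1}

/-- The tips of the spikes attached to the unit box of `F × ℝ × ℝ`, whose heights tend to `0`. -/
def spikeTips (y : ℕ → sphere (0 : F) 1) : Set (F × ℝ × ℝ) :=
  ⋃ n, spikeLayer (y n : F) (spikeHeight n)

/-- The closed convex hull of the spike tips. If every point of the sphere is a cluster point of
`y`, this is the unit box with countably many spikes along the second coordinate. -/
def spikeBody (y : ℕ → sphere (0 : F) 1) : Set (F × ℝ × ℝ) :=
  closure (convexHull ℝ (spikeTips y))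

variable {x : F} {u : ℝ} {p d : F × ℝ × ℝ} {y : ℕ → sphere (0 : F) 1}

theorem mem_spikeTips : p ∈ spikeTips y ↔ ∃ n, p ∈ spikeLayer (y n : F) (spikeHeight n) :=
  mem_iUnion

theorem countable_spikeTips : (spikeTips y).Countable :=
  countable_iUnion fun _ => ((toFinite _).prod ((toFinite _).prod (toFinite _))).countable

theorem nonempty_spikeTips : (spikeTips y).Nonempty :=
  ⟨(_, _, _), mem_spikeTips.2 ⟨0, mem_insert _ _, mem_insert _ _, mem_insert _ _⟩⟩

theorem neg_mem_spikeTips (hp : p ∈ spikeTips y) : -p ∈ spikeTips y := by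
  obtain ⟨n, h₁, h₂, h₃⟩ := mem_spikeTips.1 hp
  exact mem_spikeTips.2 ⟨n, neg_mem_pair_neg h₁, neg_mem_pair_neg h₂, neg_mem_pair_neg h₃⟩

theorem norm_eq_of_mem_spikeLayer (hx : ‖x‖ = 1) (hu₀ : 0 ≤ u) (hu₁ : u ≤ 1)
    (hp : p ∈ spikeLayer x u) : ‖p.1‖ = 1 - u ^ 2 ∧ ‖p.2.1‖ = 1 + u ∧ ‖p.2.2‖ = 1 := by
  obtain ⟨h₁, h₂, h₃⟩ := hp
  refine ⟨(norm_eq_of_mem_pair_neg h₁).trans ?_, (norm_eq_of_mem_pair_neg h₂).trans ?_,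
    (norm_eq_of_mem_pair_neg h₃).trans norm_one⟩
  · rw [norm_smul_of_nonneg (sub_nonneg.2 (pow_le_one₀ hu₀ hu₁)), hx, mul_one]
  · exact Real.norm_of_nonneg (add_nonneg zero_le_one hu₀)

theorem exists_exposing_functional (p : F × ℝ × ℝ) {w : ℝ} (hw : 0 ≤ w) :
    ∃ f : F × ℝ × ℝ →L[ℝ] ℝ, f p = ‖p.1‖ + w * ‖p.2.1‖ + ‖p.2.2‖ ∧
      (∀ d, f d ≤ ‖d.1‖ + w * ‖d.2.1‖ + ‖d.2.2‖) ∧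
      ∀ d : F × ℝ × ℝ, d.1 = p.1 ∨ d.1 = -p.1 → d.2.1 = p.2.1 ∨ d.2.1 = -p.2.1 →
        d.2.2 = p.2.2 ∨ d.2.2 = -p.2.2 → d ≠ p →
        f d + 2 * min ‖p.1‖ (min (w * ‖p.2.1‖) ‖p.2.2‖) ≤ f p := by
  obtain ⟨g₁, hg₁, hgp₁⟩ := exists_dual_vector'' ℝ p.1
  obtain ⟨g₂, hg₂, hgp₂⟩ := exists_dual_vector'' ℝ p.2.1
  obtain ⟨g₃, hg₃, hgp₃⟩ := exists_dual_vector'' ℝ p.2.2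
  simp only [RCLike.ofReal_real_eq_id, id_eq] at hgp₁ hgp₂ hgp₃
  let f := g₁.coprod ((w • g₂).coprod g₃)
  have hf (d : F × ℝ × ℝ) : f d = g₁ d.1 + w * g₂ d.2.1 + g₃ d.2.2 := by
    simp [f, add_assoc]
  have hfp : f p = ‖p.1‖ + w * ‖p.2.1‖ + ‖p.2.2‖ := by rw [hf, hgp₁, hgp₂, hgp₃]
  refine ⟨f, hfp, fun d => ?_, fun d h₁ h₂ h₃ hdp => ?_⟩
  · rw [hf]
    gcongr
    exacts [apply_le_norm_of_norm_le_one hg₁ _, apply_le_norm_of_norm_le_one hg₂ _,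
      apply_le_norm_of_norm_le_one hg₃ _]
  · have hmin₁ := min_le_left ‖p.1‖ (min (w * ‖p.2.1‖) ‖p.2.2‖)
    have hmin := min_le_right ‖p.1‖ (min (w * ‖p.2.1‖) ‖p.2.2‖)
    have hmin₂ := hmin.trans (min_le_left _ _)
    have hmin₃ := hmin.trans (min_le_right _ _)
    have h₀₁ := norm_nonneg p.1
    have h₀₂ := mul_nonneg hw (norm_nonneg p.2.1)
    rw [hfp, hf]
    rcases h₁ with h₁ | h₁ <;> rcases h₂ with h₂ | h₂ <;> rcases h₃ with h₃ | h₃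
    · exact absurd (Prod.ext h₁ (Prod.ext h₂ h₃)) hdp
    all_goals
      simp only [h₁, h₂, h₃, map_neg, hgp₁, hgp₂, hgp₃]
      linarith

theorem exists_add_le_apply_of_mem_spikeTips (hp : p ∈ spikeTips y) :
    ∃ (f : F × ℝ × ℝ →L[ℝ] ℝ) (δ : ℝ), 0 < δ ∧ ∀ d ∈ spikeTips y, d ≠ p → f d + δ ≤ f p := by
  obtain ⟨n, hpn⟩ := mem_spikeTips.1 hp
  set u := spikeHeight n
  have hu : 0 < u := spikeHeight_pos n
  have hu' : u ≤ 1 / 2 := spikeHeight_le_half n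
  have hnorm {d : F × ℝ × ℝ} {m : ℕ} := norm_eq_of_mem_spikeLayer (p := d)
    (mem_sphere_zero_iff_norm.1 (y m).2) (spikeHeight_pos m).le
    ((spikeHeight_le_half m).trans (by norm_num))
  obtain ⟨hp₁, hp₂, hp₃⟩ := hnorm hpn
  obtain ⟨f, hfp, hle, hsign⟩ := exists_exposing_functional p (by positivity : 0 ≤ 2 * u)
  refine ⟨f, u ^ 2 / 4, by positivity, fun d hd hdp => ?_⟩
  obtain ⟨m, hdm⟩ := mem_spikeTips.1 hd
  obtain ⟨hd₁, hd₂, hd₃⟩ := hnorm hdm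
  rcases eq_or_ne m n with rfl | hmn
  · have hmin : u ^ 2 / 8 ≤ min ‖p.1‖ (min (2 * u * ‖p.2.1‖) ‖p.2.2‖) := by
      rw [hp₁, hp₂, hp₃]
      refine le_min ?_ (le_min ?_ ?_) <;> nlinarith
    linarith [hsign d (eq_or_eq_neg_of_mem_pair_neg hdm.1 hpn.1)
      (eq_or_eq_neg_of_mem_pair_neg hdm.2.1 hpn.2.1)
      (eq_or_eq_neg_of_mem_pair_neg hdm.2.2 hpn.2.2) hdp]
  · have hgap : f d + (spikeHeight m - u) ^ 2 ≤ f p := by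
      refine (add_le_add_left (hle d) _).trans_eq ?_
      rw [hfp, hp₁, hp₂, hp₃, hd₁, hd₂, hd₃]
      ring
    linarith [sq_spikeHeight_div_four_le hmn]

theorem spikeTips_subset :
    spikeTips y ⊆ closedBall 0 1 ×ˢ closedBall 0 2 ×ˢ closedBall 0 1 := by
  intro p hp
  obtain ⟨n, hpn⟩ := mem_spikeTips.1 hp
  have hu := spikeHeight_le_half n
  obtain ⟨h₁, h₂, h₃⟩ := norm_eq_of_mem_spikeLayer (mem_sphere_zero_iff_norm.1 (y n).2)
    (spikeHeight_pos n).le (hu.trans (by norm_num)) hpn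
  simp only [mem_prod, mem_closedBall_zero_iff, h₁, h₂, h₃]
  exact ⟨sub_le_self _ (sq_nonneg _), by linarith, le_rfl⟩

theorem isBounded_spikeTips : IsBounded (spikeTips y) :=
  (isBounded_closedBall.prod (isBounded_closedBall.prod isBounded_closedBall)).subset
    spikeTips_subset

theorem isSymmetricConvexClosedBounded_spikeBody : IsSymmetricConvexClosedBounded (spikeBody y) :=
  isSymmetricConvexClosedBounded_closure_convexHull isBounded_spikeTips
    fun _ => neg_mem_spikeTips

theorem isSCD_spikeBody : IsSCD (spikeBody y) :=
  isSCD_closure_convexHull_of_isDentingPoint countable_spikeTips nonempty_spikeTips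
    isBounded_spikeTips fun p hp => by
      obtain ⟨f, δ, hδ, hf⟩ := exists_add_le_apply_of_mem_spikeTips hp
      exact isDentingPoint_closure_convexHull isBounded_spikeTips hp hδ hf

theorem spikeBody_subset : spikeBody y ⊆ closedBall 0 1 ×ˢ closedBall 0 2 ×ˢ closedBall 0 1 :=
  closure_minimal
    (convexHull_min spikeTips_subset
      ((convex_closedBall 0 1).prod ((convex_closedBall 0 2).prod (convex_closedBall 0 1))))
    (isClosed_closedBall.prod (isClosed_closedBall.prod isClosed_closedBall))

theorem sphere_prod_subset_closure_spikeTips (hy : ∀ a, MapClusterPt a atTop y) :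
    sphere 0 1 ×ˢ sphere 0 1 ×ˢ sphere 0 1 ⊆ closure (spikeTips y) := by
  rintro ⟨a, s, t⟩ ⟨ha, hs, ht⟩
  obtain ⟨k, hk, hlim⟩ := (hy ⟨a, ha⟩).tendsto_subseq
  have hu : Tendsto (fun j => spikeHeight (k j)) atTop (𝓝 0) :=
    tendsto_spikeHeight.comp hk.tendsto_atTop
  have hlim₁ : Tendsto (fun j => (1 - spikeHeight (k j) ^ 2) • (y (k j) : F)) atTop (𝓝 a) := by
    simpa using ((hu.pow 2).const_sub 1).smul ((continuous_subtype_val.tendsto _).comp hlim)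
  have hlim₂ : Tendsto (fun j => s * (1 + spikeHeight (k j))) atTop (𝓝 s) := by
    simpa using (hu.const_add 1).const_mul s
  refine mem_closure_of_tendsto (hlim₁.prodMk_nhds (hlim₂.prodMk_nhds tendsto_const_nhds))
    (Eventually.of_forall fun j => mem_spikeTips.2 ⟨k j, mem_insert _ _, ?_, ?_⟩)
  · rcases eq_or_eq_neg_of_abs_eq (mem_sphere_zero_iff_norm.1 hs) with rfl | rfl <;> simp
  · exact eq_or_eq_neg_of_abs_eq (mem_sphere_zero_iff_norm.1 ht)

theorem closedBall_subset_spikeBody [Nontrivial F] (hy : ∀ a, MapClusterPt a atTop y) :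
    closedBall 0 1 ⊆ spikeBody y := by
  calc closedBall 0 1 = convexHull ℝ (sphere 0 1 ×ˢ sphere 0 1 ×ˢ sphere 0 1) := by
        simp only [convexHull_prod, convexHull_sphere_eq_closedBall _ zero_le_one,
          closedBall_prod_same, Prod.mk_zero_zero]
    _ ⊆ spikeBody y :=
        convexHull_min ((sphere_prod_subset_closure_spikeTips hy).trans
          (closure_mono (subset_convexHull ℝ _))) (convex_convexHull ℝ _).closure

variable (F) in
/-- The automorphism of `F × ℝ × ℝ` interchanging the two real coordinates. -/
def swapScalars : (F × ℝ × ℝ) ≃L[ℝ] F × ℝ × ℝ :=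
  (ContinuousLinearEquiv.refl ℝ F).prodCongr (ContinuousLinearEquiv.prodComm ℝ ℝ ℝ)

theorem spikeBody_inter_image_swapScalars [Nontrivial F] (hy : ∀ a, MapClusterPt a atTop y) :
    spikeBody y ∩ swapScalars F '' spikeBody y = closedBall 0 1 := by
  refine Subset.antisymm ?_ (subset_inter (closedBall_subset_spikeBody hy) ?_)
  · rintro _ ⟨hp, p, hp', rfl⟩
    obtain ⟨h₁, -, h₃⟩ := spikeBody_subset hp
    obtain ⟨-, -, h₂⟩ := spikeBody_subset hp'
    exact closedBall_prod_same (0 : F) (0 : ℝ × ℝ) 1 ▸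
      ⟨h₁, closedBall_prod_same (0 : ℝ) (0 : ℝ) 1 ▸ ⟨h₂, h₃⟩⟩
  · intro p hp
    refine ⟨swapScalars F p, closedBall_subset_spikeBody hy ?_, rfl⟩
    simpa [swapScalars, Prod.norm_def, and_comm] using hp

end Spikes

section Bodies

open TopologicalSpace

variable {X Z : Type*} [NormedAddCommGroup X] [NormedSpace ℝ X] [NormedAddCommGroup Z]
  [NormedSpace ℝ Z]

/-- Symmetric convex closed bounded SCD sets with non-empty interior. -/
structure IsSymmetricSCDBody (C : Set X) : Prop extends IsSymmetricConvexClosedBounded C where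
  nonempty_interior : (interior C).Nonempty
  isSCD : IsSCD C

theorem IsSymmetricSCDBody.image [Nontrivial Z] {C : Set Z} (hC : IsSymmetricSCDBody C)
    (e : Z ≃L[ℝ] X) : IsSymmetricSCDBody (e '' C) where
  toIsSymmetricConvexClosedBounded := hC.toIsSymmetricConvexClosedBounded.image
    (T := (e : Z →L[ℝ] X)) e.toHomeomorph.isClosedEmbedding
  nonempty_interior :=
    (hC.nonempty_interior.image e).mono (e.toHomeomorph.isOpenMap.image_interior_subset C)
  isSCD := (isSCD_image_iff (T := (e : Z →L[ℝ] X)) e.toHomeomorph.isEmbedding).2 hC.isSCD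

theorem isSymmetricSCDBody_spikeBody [Nontrivial X] {y : ℕ → sphere (0 : X) 1}
    (hy : ∀ a, MapClusterPt a atTop y) : IsSymmetricSCDBody (spikeBody y) where
  toIsSymmetricConvexClosedBounded := isSymmetricConvexClosedBounded_spikeBody
  nonempty_interior := ⟨0, interior_mono (closedBall_subset_spikeBody hy)
    (ball_subset_interior_closedBall (mem_ball_self one_pos))⟩
  isSCD := isSCD_spikeBody

theorem exists_isSymmetricSCDBody_inter_eq_closedBall (X : Type*) [NormedAddCommGroup X]
    [NormedSpace ℝ X] [Nontrivial X] [SeparableSpace X] :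
    ∃ C₁ C₂ : Set (X × ℝ × ℝ), IsSymmetricSCDBody C₁ ∧ IsSymmetricSCDBody C₂ ∧
      C₁ ∩ C₂ = closedBall 0 1 := by
  have : SecondCountableTopology X := UniformSpace.secondCountable_of_separable X
  have : Nonempty (sphere (0 : X) 1) := (NormedSpace.sphere_nonempty.2 zero_le_one).to_subtype
  obtain ⟨y, hy⟩ := exists_seq_forall_mapClusterPt (sphere (0 : X) 1)
  have hbody := isSymmetricSCDBody_spikeBody hy
  exact ⟨_, _, hbody, hbody.image (swapScalars X), spikeBody_inter_image_swapScalars hy⟩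

theorem exists_submodule_finrank_eq (hX : ¬ FiniteDimensional ℝ X) (n : ℕ) :
    ∃ G : Submodule ℝ X, FiniteDimensional ℝ G ∧ Module.finrank ℝ G = n := by
  have hrank : (n : Cardinal) ≤ Module.rank ℝ X :=
    (Cardinal.natCast_lt_aleph0 (n := n)).le.trans
      (not_lt.1 fun h => hX (Module.rank_lt_aleph0_iff.1 h))
  obtain ⟨s, hs, hli⟩ := exists_finset_linearIndependent_of_le_rank hrank
  exact ⟨Submodule.span ℝ s, inferInstance, by rw [finrank_span_finset_eq_card hli, hs]⟩

theorem nonempty_quotient_prod_equiv (G : Submodule ℝ X) [FiniteDimensional ℝ G]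
    [FiniteDimensional ℝ Z] (h : Module.finrank ℝ G = Module.finrank ℝ Z) :
    Nonempty (((X ⧸ G) × Z) ≃L[ℝ] X) := by
  obtain ⟨H, hH⟩ := (Submodule.ClosedComplemented.of_finiteDimensional G).exists_isTopCompl
  have e : G ≃L[ℝ] Z := ContinuousLinearEquiv.ofFinrankEq h
  exact ⟨(((Submodule.quotientEquivOfIsTopCompl G H hH).prodCongr e.symm).trans
    (ContinuousLinearEquiv.prodComm ℝ H G)).trans (Submodule.prodEquivOfIsTopCompl G H hH)⟩

theorem HasDaugavetHullProperty.exists_isSymmetricSCDBody_not_isSCD_inter [Nontrivial X]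
    [SeparableSpace X] (hX : HasDaugavetHullProperty X) :
    ∃ C₁ C₂ : Set X, IsSymmetricSCDBody C₁ ∧ IsSymmetricSCDBody C₂ ∧ ¬ IsSCD (C₁ ∩ C₂) := by
  obtain ⟨G, hGfin, hG⟩ := exists_submodule_finrank_eq hX.not_finiteDimensional 2
  have : IsClosed (G : Set X) := G.closed_of_finiteDimensional
  have : SeparableSpace (X ⧸ G) :=
    G.mkQ_surjective.denseRange.separableSpace G.mkQL.continuous
  have : Nontrivial (X ⧸ G) := by
    rw [Submodule.Quotient.nontrivial_iff]
    rintro rfl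
    exact hX.not_finiteDimensional (Submodule.topEquiv.finiteDimensional)
  obtain ⟨e⟩ := nonempty_quotient_prod_equiv (Z := ℝ × ℝ) G (by simp [hG])
  obtain ⟨C₁, C₂, h₁, h₂, hinter⟩ := exists_isSymmetricSCDBody_inter_eq_closedBall (X ⧸ G)
  refine ⟨_, _, h₁.image e, h₂.image e, ?_⟩
  rw [← image_inter e.injective, hinter]
  refine (isSCD_image_iff (T := (e : ((X ⧸ G) × ℝ × ℝ) →L[ℝ] X))
    e.toHomeomorph.isEmbedding).not.2 ?_
  rw [← Prod.mk_zero_zero, ← closedBall_prod_same]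
  exact hX.not_isSCD_closedBall_quotient_prod G _

end Bodies

theorem mainTheorem8_general (Y : Type*) [NormedAddCommGroup Y] [NormedSpace ℝ Y]
    [Nontrivial Y] (hY : HasDaugavetProperty Y) :
    (∃ C₁ C₂ : Set Y,
      IsSymmetricConvexClosedBounded C₁ ∧ IsSymmetricConvexClosedBounded C₂ ∧
      IsSCD C₁ ∧ IsSCD C₂ ∧ ¬ IsSCD (C₁ ∩ C₂)) ∧
    (TopologicalSpace.SeparableSpace Y →
      ∃ C₁ C₂ : Set Y,
        IsSymmetricConvexClosedBounded C₁ ∧ (interior C₁).Nonempty ∧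
        IsSymmetricConvexClosedBounded C₂ ∧ (interior C₂).Nonempty ∧
        IsSCD C₁ ∧ IsSCD C₂ ∧ ¬ IsSCD (C₁ ∩ C₂)) := by
  have hhull := hY.hasDaugavetHullProperty
  refine ⟨?_, fun _ => ?_⟩
  · obtain ⟨v, hv⟩ := exists_ne (0 : Y)
    obtain ⟨M, hvM, hMclosed, hMsep, hM⟩ := hhull.exists_isSeparable_submodule
      (M₀ := ℝ ∙ v) (countable_singleton v).isSeparable.span
    have : TopologicalSpace.SeparableSpace M := hMsep.separableSpace
    have : Nontrivial M := ⟨⟨v, hvM (Submodule.mem_span_singleton_self v)⟩, 0, by simpa using hv⟩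
    obtain ⟨C₁, C₂, h₁, h₂, hinter⟩ := hM.exists_isSymmetricSCDBody_not_isSCD_inter
    have hemb : IsClosedEmbedding M.subtypeL := hMclosed.isClosedEmbedding_subtypeVal
    refine ⟨M.subtypeL '' C₁, M.subtypeL '' C₂, h₁.toIsSymmetricConvexClosedBounded.image hemb,
      h₂.toIsSymmetricConvexClosedBounded.image hemb, (isSCD_image_iff hemb.isEmbedding).2 h₁.isSCD,
      (isSCD_image_iff hemb.isEmbedding).2 h₂.isSCD, ?_⟩
    rwa [← image_inter hemb.injective, isSCD_image_iff hemb.isEmbedding]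
  · obtain ⟨C₁, C₂, h₁, h₂, hinter⟩ := hhull.exists_isSymmetricSCDBody_not_isSCD_inter
    exact ⟨C₁, C₂, h₁.toIsSymmetricConvexClosedBounded, h₁.nonempty_interior,
      h₂.toIsSymmetricConvexClosedBounded, h₂.nonempty_interior, h₁.isSCD, h₂.isSCD, hinter⟩

end CounterexampleToIntersections

theorem mainTheorem8 (Y : Type*) [NormedAddCommGroup Y] [NormedSpace ℝ Y] [CompleteSpace Y]
    [Nontrivial Y] (hY : HasDaugavetProperty Y) :
    (∃ C₁ C₂ : Set Y,
      IsSymmetricConvexClosedBounded C₁ ∧ IsSymmetricConvexClosedBounded C₂ ∧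
      IsSCD C₁ ∧ IsSCD C₂ ∧ ¬ IsSCD (C₁ ∩ C₂)) ∧
    (TopologicalSpace.SeparableSpace Y →
      ∃ C₁ C₂ : Set Y,
        IsSymmetricConvexClosedBounded C₁ ∧ (interior C₁).Nonempty ∧
        IsSymmetricConvexClosedBounded C₂ ∧ (interior C₂).Nonempty ∧
        IsSCD C₁ ∧ IsSCD C₂ ∧ ¬ IsSCD (C₁ ∩ C₂)) :=
  mainTheorem8_general Y hY
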